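/- **Conventions.** A *rig* is a commutative semiring with $0$ and $1$; it is *integral* if $1+x=1$ for all $x$. $\mathbf{iRig}$ is the category of integral rigs in $\mathbf{Set}$ and rig morphisms, and $\mathbf{dLat}\to\mathbf{iRig}$ is the full subcategory of (bounded) distributive lattices, with $+=\vee$ and $\cdot=\wedge$. The *reticulation* functor $L:\mathbf{iRig}\to\mathbf{dLat}$ is the left adjoint of this inclusion, with unit $\eta_A:A\to LA$. For $A$ in $\mathbf{iRig}$ and $a\in A$, $A\to A[a^{-1}]$ denotes the universal morphism in $\mathbf{iRig}$ that inverts all powers of $a$. For a distributive lattice $D$, $\mathbf{Shv}(D)$ is the topos of sheaves on $D$ for the coherent coverage (the finite families $(d_i\le d)$ with $\bigvee_i d_i=d$ cover $d$). An integral rig $X$ in $\mathbf{Shv}(D)$ is a functor $X:D^{op}\to\mathbf{iRig}$ whose underlying presheaf of sets is a sheaf; for $x\in X(d)$ and $c\le d$ let $x\cdot c\in X(c)$ be the restriction. A morphism of rigs $X\to Y$ in $\mathbf{Shv}(D)$ is *local* if the subobject of invertible elements of $X$ is the pullback of that of $Y$. $X$ is *really local* if there is a (necessarily unique) local morphism of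 rigs $X\to\Omega$, where $\Omega$ is the subobject classifier of $\mathbf{Shv}(D)$, regarded as an internal distributive lattice. A subobject $U\to X$ is *principal* if for all $d\in D$ and $x\in X(d)$ there is a largest $c\le d$ with $x\cdot c\in U(c)$. Let $\Lambda_D$ be the distributive lattice in $\mathbf{Shv}(D)$ with $\Lambda_D(d)=\{a\mid a\le d\}$ and $a\cdot c=a\wedge c$. A *representation* is a pair $(D,X)$ with $D$ a distributive lattice and $X$ a really local integral rig in $\mathbf{Shv}(D)$ such that the subobject $1:1\to X$ is principal. For such a pair there is a unique local morphism of rigs $\chi_X:X\to\Lambda_D$; it sends $x\in X(d)$ to the largest $c\le d$ with $x\cdot c=1$. The category $\mathfrak I$ has representations as objects. A morphism $(D,X)\to(E,Y)$ is a pair $(f,\phi)$ consisting of a morphism $f:D\to E$ in $\mathbf{dLat}$ and a morphism of rigs $\phi:X\to f_*Y$, where $(f_*Y)(d)=Y(f d)$, such that $(f_*\chi_Y)\,\phi=\widehat f\,\chi_X$; here $\widehat f:\Lambda_D\to f_*\Lambda_E$ sends $a\le d$ to $f a\le f d$. The composite of $(g,\gamma):(C,W)\to(D,X)$ with $(f,\phi)$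 is $(f g,(g_*\phi)\gamma)$. The global sections functor $\Gamma:\mathfrak I\to\mathbf{iRig}$ sends $(D,X)$ to $X(\top)$ and $(f,\phi)$ to $\phi_\top: X(\top)\to Y(f\top)=Y(\top)$. **Theorem.** The functor $\Gamma:\mathfrak I\to\mathbf{iRig}$ has a full and faithful left adjoint. This left adjoint sends an integral rig $A$ to a representation $(LA,\overline A)$, where: 1. $LA$ is the reticulation of $A$, functorially in $A$ (that is, the left adjoint followed by $(D,X)\mapsto D$ is the reticulation functor $L$), and its unit $\eta_A:A\to LA$ is surjective; 2. for every $x\in A$, $\overline A(\eta_A x)=A[x^{-1}]$; more precisely, the composite of the unit $A\to\Gamma(LA,\overline A)=\overline A(\top)$ of the adjunction with the restriction map $\overline A(\top)\to\overline A(\eta_A x)$ is the localization $A\to A[x^{-1}]$; 3. the unit $A\to\Gamma(LA,\overline A)$ is an isomorphism. -/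

import Mathlib

open CategoryTheory Opposite

universe u

/-! ### Integral rigs -/

/-- An integral rig in `Set`: a commutative rig (commutative semiring) in which `1 + x = 1`. -/
structure IRig : Type (u + 1) where
  /-- The underlying set. -/
  carrier : Type u
  [str : CommSemiring carrier]
  one_add : ∀ x : carrier, 1 + x = 1

namespace IRig

instance : CoeSort IRig.{u} (Type u) := ⟨carrier⟩

attribute [instance] IRig.str

/-- Morphisms of integral rigs are rig morphisms. -/
@[ext]
structure Hom (A B : IRig.{u}) where
  /-- The underlying map preserving `0`, `1`, `+` and `·`. -/
  hom : A →+* B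

/-- The category `iRig`. -/
instance : Category IRig.{u} where
  Hom A B := Hom A B
  id A := ⟨RingHom.id A⟩
  comp f g := ⟨g.hom.comp f.hom⟩

instance : ConcreteCategory IRig.{u} (fun A B => A →+* B) where
  hom := Hom.hom
  ofHom f := ⟨f⟩

@[ext]
theorem hom_ext {A B : IRig.{u}} {f g : A ⟶ B} (h : ∀ x : A, f x = g x) : f = g :=
  Hom.ext (RingHom.ext h)

@[simp]
theorem id_apply' {A : IRig.{u}} (x : A) : (𝟙 A : A ⟶ A) x = x := rfl

@[simp]
theorem comp_apply' {A B C : IRig.{u}} (f : A ⟶ B) (g : B ⟶ C) (x : A) :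
    (f ≫ g) x = g (f x) := rfl

/-- In an integral rig the only invertible element is `1`. -/
theorem isUnit_iff (A : IRig.{u}) (x : A) : IsUnit x ↔ x = 1 := by
  constructor
  · rintro ⟨v, rfl⟩
    have h1 : (v : A) + 1 = 1 := by rw [add_comm]; exact A.one_add _
    have h2 : (v : A) + 1 = v := by
      calc (v : A) + 1 = v * 1 + v * (v⁻¹ : Aˣ) := by simp
        _ = v * (1 + (v⁻¹ : Aˣ)) := by rw [mul_add]
        _ = v := by rw [A.one_add, mul_one]
    exact h2.symm.trans h1
  · rintro rfl
    exact isUnit_one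

theorem eq_one_of_mul_eq_one (A : IRig.{u}) {x y : A} (h : x * y = 1) : x = 1 :=
  (A.isUnit_iff x).1 (IsUnit.of_mul_eq_one _ h)

/-- `l : A ⟶ B` is a solution, in `iRig`, of the universal problem of inverting all elements
of `S`. -/
structure IsLocalization {A B : IRig.{u}} (S : Set A) (l : A ⟶ B) : Prop where
  isUnit : ∀ s ∈ S, IsUnit (l s)
  lift : ∀ (C : IRig.{u}) (g : A ⟶ C), (∀ s ∈ S, IsUnit (g s)) → ∃! h : B ⟶ C, l ≫ h = g

/-- `l : A ⟶ B` is (up to unique isomorphism) the localization `A ⟶ A[a⁻¹]`, that is, the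
universal solution of inverting all the powers of `a`. -/
def IsLocalizationAt {A B : IRig.{u}} (a : A) (l : A ⟶ B) : Prop :=
  IsLocalization (Submonoid.powers a : Set A) l

end IRig

/-- A bounded distributive lattice is an integral rig with `+ = ⊔`, `0 = ⊥`, `· = ⊓`, `1 = ⊤`. -/
def latticeRig (L : Type u) [DistribLattice L] [BoundedOrder L] : IRig.{u} where
  carrier := L
  str :=
    { add := (· ⊔ ·)
      zero := ⊥
      mul := (· ⊓ ·)
      one := ⊤
      add_assoc := sup_assoc
      zero_add := bot_sup_eq
      add_zero := sup_bot_eq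
      add_comm := sup_comm
      nsmul := @nsmulRec L ⟨⊥⟩ ⟨(· ⊔ ·)⟩
      mul_assoc := inf_assoc
      one_mul := top_inf_eq
      mul_one := inf_top_eq
      mul_comm := inf_comm
      zero_mul := bot_inf_eq
      mul_zero := inf_bot_eq
      left_distrib := inf_sup_left
      right_distrib := inf_sup_right }
  one_add := top_sup_eq

/-- The full inclusion `dLat ⥤ iRig` of bounded distributive lattices into integral rigs. -/
def dLatToIRig : BddDistLat.{u} ⥤ IRig.{u} where
  obj L := latticeRig L
  map {L M} f :=
    ⟨{ toFun := fun x => f.hom x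
       map_one' := map_top f.hom
       map_mul' := f.hom.map_inf'
       map_zero' := map_bot f.hom
       map_add' := f.hom.map_sup' }⟩

/-! ### The topos of sheaves on a distributive lattice -/

/-- The coherent coverage on a distributive lattice `D`, seen as a category: a sieve on `d` is
covering if and only if it contains a finite family `(dᵢ ≤ d)` with `⋁ dᵢ = d`. -/
def coherentCoverage (D : BddDistLat.{u}) : GrothendieckTopology D where
  sieves d := {S | ∃ t : Finset D, t.sup id = d ∧ ∀ c ∈ t, ∃ h : c ⟶ d, S h}
  top_mem' d := ⟨{d}, by simp, fun c hc => by
    obtain rfl := Finset.mem_singleton.1 hc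
    exact ⟨𝟙 _, trivial⟩⟩
  pullback_stable' d e S f := by
    classical
    rintro ⟨t, ht, hS⟩
    refine ⟨t.image (fun c => e ⊓ c), ?_, ?_⟩
    · rw [Finset.sup_image, Function.id_comp, show (t.sup fun c => e ⊓ c) = e ⊓ t.sup id from (Finset.sup_inf_distrib_left t id e).symm, ht]
      exact inf_eq_left.2 (leOfHom f)
    · intro c hc
      obtain ⟨a, ha, rfl⟩ := Finset.mem_image.1 hc
      obtain ⟨h, hh⟩ := hS a ha
      refine ⟨homOfLE inf_le_left, ?_⟩
      have := S.downward_closed hh (homOfLE (inf_le_right : e ⊓ a ≤ a))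
      exact this
  transitive' d S := by
    classical
    rintro ⟨t, ht, hS⟩ R hR
    have key : ∀ c ∈ t, ∃ s : Finset D, s.sup id = c ∧ ∀ b ∈ s, ∃ h : b ⟶ d, R h := by
      intro c hc
      obtain ⟨h, hh⟩ := hS c hc
      obtain ⟨s, hs, hsR⟩ := hR hh
      exact ⟨s, hs, fun b hb => by
        obtain ⟨k, hk⟩ := hsR b hb
        exact ⟨_, hk⟩⟩
    choose! s hs hsR using key
    refine ⟨t.biUnion s, ?_, ?_⟩
    · rw [Finset.sup_biUnion]
      rw [← ht]
      exact Finset.sup_congr rfl fun c hc => hs c hc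
    · intro b hb
      obtain ⟨c, hc, hbc⟩ := Finset.mem_biUnion.1 hb
      exact hsR c hc b hbc

/-- An integral rig in the topos of presheaves on `D`, that is, a functor `Dᵒᵖ ⥤ iRig`.
Integral rigs in `Shv(D)` are those satisfying `IsSheafOfRigs` below, and their morphisms are the
morphisms of presheaves of integral rigs. -/
abbrev RigPresheaf (D : BddDistLat.{u}) := (D : Type u)ᵒᵖ ⥤ IRig.{u}

/-- The underlying presheaf of sets is a sheaf for the coherent coverage. -/
def IsSheafOfRigs {D : BddDistLat.{u}} (X : RigPresheaf D) : Prop :=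
  Presieve.IsSheaf (coherentCoverage D) (X ⋙ forget IRig.{u})

/-- The restriction `x ↦ x · c` from stage `d` to stage `c ≤ d`. -/
abbrev RigPresheaf.res {D : BddDistLat.{u}} (X : RigPresheaf D) {c d : D} (h : c ≤ d) :
    X.obj (op d) ⟶ X.obj (op c) :=
  X.map (homOfLE h).op

/-- A morphism `f : X ⟶ Y` of rigs in a topos is local if `Inv X` is the pullback of `Inv Y` along
`f`; for (pre)sheaves of rigs, this is computed stage by stage. -/
def IsLocalMorphism {D : BddDistLat.{u}} {X Y : RigPresheaf D} (f : X ⟶ Y) : Prop :=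
  ∀ (d : D) (x : X.obj (op d)), IsUnit (f.app (op d) x) → IsUnit x

/-! ### The subobject classifier `Ω` of `Shv(D)` as a distributive lattice -/

section Omega

variable {D : BddDistLat.{u}}

/-- The set of closed sieves on `d`, for the coherent coverage: the value at `d` of the subobject
classifier of `Shv(D)`. -/
abbrev ClosedSieve (d : D) : Type u := {S : Sieve d // (coherentCoverage D).IsClosed S}

theorem ClosedSieve.isClosed_inf {d : D} {S T : Sieve d} (hS : (coherentCoverage D).IsClosed S)
    (hT : (coherentCoverage D).IsClosed T) : (coherentCoverage D).IsClosed (S ⊓ T) := fun _ f hf =>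
  ⟨hS f ((coherentCoverage D).superset_covering (Sieve.pullback_monotone f inf_le_left) hf),
    hT f ((coherentCoverage D).superset_covering (Sieve.pullback_monotone f inf_le_right) hf)⟩

/-- Closed sieves ordered by inclusion: meets are intersections, and joins are the closures of
unions. -/
instance (d : D) : Lattice (ClosedSieve d) where
  sup S T := ⟨(coherentCoverage D).close (S.1 ⊔ T.1), (coherentCoverage D).close_isClosed _⟩
  inf S T := ⟨S.1 ⊓ T.1, ClosedSieve.isClosed_inf S.2 T.2⟩
  le_sup_left S T := le_trans (b := S.1 ⊔ T.1) le_sup_left ((coherentCoverage D).le_close _)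
  le_sup_right S T := le_trans (b := S.1 ⊔ T.1) le_sup_right ((coherentCoverage D).le_close _)
  sup_le _ _ U h1 h2 := (coherentCoverage D).le_close_of_isClosed (sup_le h1 h2) U.2
  inf_le_left S T := show S.1 ⊓ T.1 ≤ S.1 from inf_le_left
  inf_le_right S T := show S.1 ⊓ T.1 ≤ T.1 from inf_le_right
  le_inf S T U h1 h2 := show S.1 ≤ T.1 ⊓ U.1 from le_inf h1 h2

instance (d : D) : DistribLattice (ClosedSieve d) where
  le_sup_inf := by
    rintro S T U c f ⟨h1, h2⟩
    have h := (coherentCoverage D).intersection_covering h1 h2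
    refine (coherentCoverage D).superset_covering ?_ h
    rintro b g ⟨hg1, hg2⟩
    change (S.1 (g ≫ f) ∨ T.1 (g ≫ f)) at hg1
    change (S.1 (g ≫ f) ∨ U.1 (g ≫ f)) at hg2
    change (S.1 (g ≫ f) ∨ (T.1 (g ≫ f) ∧ U.1 (g ≫ f)))
    tauto

instance (d : D) : BoundedOrder (ClosedSieve d) where
  top := ⟨⊤, fun _ _ _ => trivial⟩
  le_top S := show S.1 ≤ ⊤ from le_top
  bot := ⟨(coherentCoverage D).close ⊥, (coherentCoverage D).close_isClosed _⟩
  bot_le S := (coherentCoverage D).le_close_of_isClosed bot_le S.2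

/-- Restriction of closed sieves is a morphism of distributive lattices. -/
def ClosedSieve.pullback {d e : D} (f : e ⟶ d) :
    BoundedLatticeHom (ClosedSieve d) (ClosedSieve e) where
  toFun S := ⟨S.1.pullback f, (coherentCoverage D).isClosed_pullback f _ S.2⟩
  map_sup' S T := Subtype.ext ((coherentCoverage D).pullback_close f (S.1 ⊔ T.1)).symm
  map_inf' _ _ := Subtype.ext rfl
  map_top' := Subtype.ext rfl
  map_bot' := Subtype.ext ((coherentCoverage D).pullback_close f ⊥).symm

variable (D)

/-- The subobject classifier of `Shv(D)`, with its internal structure of distributive lattice. -/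
def omegaLattice : (D : Type u)ᵒᵖ ⥤ BddDistLat.{u} where
  obj d := BddDistLat.of (ClosedSieve d.unop)
  map f := BddDistLat.ofHom (ClosedSieve.pullback f.unop)
  map_id d := by
    refine BddDistLat.ext fun (S : ClosedSieve d.unop) => ?_
    exact Subtype.ext (Sieve.pullback_id (S := S.1))
  map_comp {d c b} f g := by
    refine BddDistLat.ext fun (S : ClosedSieve d.unop) => ?_
    exact Subtype.ext (Sieve.pullback_comp S.1)

/-- The subobject classifier `Ω` as an integral rig in `Shv(D)`. -/
def omegaRig : RigPresheaf D := omegaLattice D ⋙ dLatToIRig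

end Omega

/-- A rig `X` in `Shv(D)` is really local if there is a (necessarily unique) local morphism of rigs
`X ⟶ Ω`. -/
def IsReallyLocal {D : BddDistLat.{u}} (X : RigPresheaf D) : Prop :=
  ∃ ι : X ⟶ omegaRig D, IsLocalMorphism ι

/-! ### Principal subobjects and their classifier `Λ` -/

/-- A subobject `U` of `X` is principal if for every `x ∈ X d` there is a largest `c ≤ d` such
that `x · c ∈ U c`. -/
def IsPrincipal {D : BddDistLat.{u}} {X : (D : Type u)ᵒᵖ ⥤ Type u} (U : Subfunctor X) : Prop :=
  ∀ (d : D) (x : X.obj (op d)),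
    ∃ c : D, IsGreatest {c : D | ∃ h : c ≤ d, X.map (homOfLE h).op x ∈ U.obj (op c)} c

/-- The subobject `1 : 1 ⟶ X` of a rig `X`. -/
def unitSubobject {D : BddDistLat.{u}} (X : RigPresheaf D) : Subfunctor (X ⋙ forget IRig.{u}) where
  obj d := {x : X.obj d | x = 1}
  map {c d} f := by
    rintro x rfl
    exact map_one (X.map f).hom

section Lambda

variable (D : BddDistLat.{u})

instance (d : D) : DistribLattice (Set.Iic d) where
  le_sup_inf x y z := le_sup_inf (x := (x : D)) (y := y) (z := z)

/-- The sheaf `Λ`, with `Λ d = {a | a ≤ d}` and `a · c = a ⊓ c`, as a presheaf of distributive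
lattices. -/
def lambdaLattice : (D : Type u)ᵒᵖ ⥤ BddDistLat.{u} where
  obj d := BddDistLat.of (Set.Iic d.unop)
  map {d c} f := BddDistLat.ofHom
    { toFun := fun a => ⟨a ⊓ c.unop, inf_le_right⟩
      map_sup' := fun a b => Subtype.ext (inf_sup_right _ _ _)
      map_inf' := fun a b => Subtype.ext (inf_inf_distrib_right _ _ _)
      map_top' := Subtype.ext (inf_eq_right.2 (leOfHom f.unop))
      map_bot' := Subtype.ext (bot_inf_eq _) }
  map_id d := by
    refine BddDistLat.ext fun (a : Set.Iic d.unop) => ?_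
    exact Subtype.ext (inf_eq_left.2 a.2)
  map_comp {d c b} f g := by
    refine BddDistLat.ext fun (a : Set.Iic d.unop) => ?_
    refine Subtype.ext ?_
    change (a : D) ⊓ b.unop = (a : D) ⊓ c.unop ⊓ b.unop
    rw [inf_assoc, inf_eq_right.2 (leOfHom g.unop)]

/-- The classifier `Λ` of principal subobjects as an integral rig in `Shv(D)`. -/
def lambdaRig : RigPresheaf D := lambdaLattice D ⋙ dLatToIRig

end Lambda

/-! ### Representations -/

/-- A representation (of an integral rig): a distributive lattice `D` together with a really local
integral rig `X` in `Shv(D)` whose unit `1 : 1 ⟶ X` is a principal subobject. -/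
structure RigRep : Type (u + 1) where
  /-- The lattice `D`. -/
  lat : BddDistLat.{u}
  /-- The integral rig `X`. -/
  rig : RigPresheaf lat
  isSheaf : IsSheafOfRigs rig
  isReallyLocal : IsReallyLocal rig
  isPrincipal : IsPrincipal (unitSubobject rig)

namespace RigRep

variable (R : RigRep.{u})

/-- The largest `c ≤ d` such that `x · c = 1`. -/
noncomputable def chiFun (d : R.lat) (x : R.rig.obj (op d)) : Set.Iic d :=
  ⟨(R.isPrincipal d x).choose, (R.isPrincipal d x).choose_spec.1.choose⟩

theorem le_chiFun {d : R.lat} (x : R.rig.obj (op d)) {c : R.lat} (h : c ≤ d) :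
    c ≤ (R.chiFun d x : R.lat) ↔ R.rig.res h x = 1 := by
  have hs := (R.isPrincipal d x).choose_spec
  constructor
  · intro hc
    obtain ⟨h', hx⟩ := hs.1
    have hx' : R.rig.res h' x = 1 := hx
    have e : R.rig.res h = R.rig.res h' ≫ R.rig.res hc := by
      rw [← R.rig.map_comp]
      rfl
    rw [e, IRig.comp_apply', hx']
    exact map_one (R.rig.res hc).hom
  · intro hx
    exact hs.2 ⟨h, hx⟩

/-- Two elements of `Λ d` with the same lower bounds coincide. -/
theorem iic_ext {D : BddDistLat.{u}} {d : D} {a b : Set.Iic d}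
    (h : ∀ c : D, c ≤ d → (c ≤ (a : D) ↔ c ≤ (b : D))) : a = b :=
  Subtype.ext (le_antisymm ((h a a.2).1 le_rfl) ((h b b.2).2 le_rfl))

theorem chiFun_one (d : R.lat) : R.chiFun d 1 = ⊤ :=
  iic_ext fun c h => by
    rw [le_chiFun _ _ h]
    exact ⟨fun _ => h, fun _ => map_one (R.rig.res h).hom⟩

theorem chiFun_mul (d : R.lat) (x y : R.rig.obj (op d)) :
    R.chiFun d (x * y) = R.chiFun d x ⊓ R.chiFun d y :=
  iic_ext fun c h => by
    change _ ↔ c ≤ (R.chiFun d x : R.lat) ⊓ (R.chiFun d y : R.lat)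
    rw [le_inf_iff, le_chiFun _ _ h, le_chiFun _ _ h, le_chiFun _ _ h, map_mul]
    constructor
    · intro hxy
      exact ⟨IRig.eq_one_of_mul_eq_one _ hxy,
        IRig.eq_one_of_mul_eq_one _ ((mul_comm _ _).trans hxy)⟩
    · rintro ⟨hx, hy⟩
      rw [hx, hy, mul_one]

theorem chiFun_zero (d : R.lat) : R.chiFun d 0 = ⊥ := by
  obtain ⟨ι, -⟩ := R.isReallyLocal
  have h := (R.le_chiFun (0 : R.rig.obj (op d)) (R.chiFun d 0).2).1 le_rfl
  rw [map_zero] at h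
  have h' := congrArg (ι.app (op (R.chiFun d 0 : R.lat))) h
  rw [map_zero, map_one] at h'
  have h'' : (coherentCoverage R.lat).close (⊥ : Sieve (R.chiFun d 0 : R.lat)) = ⊤ :=
    congrArg Subtype.val h'
  rw [GrothendieckTopology.close_eq_top_iff_mem] at h''
  obtain ⟨t, ht, hS⟩ := h''
  refine Subtype.ext ?_
  change (R.chiFun d 0 : R.lat) = ⊥
  rw [← ht]
  refine le_antisymm (Finset.sup_le fun c hc => ?_) bot_le
  obtain ⟨_, hf⟩ := hS c hc
  exact hf.elim

theorem chiFun_add (d : R.lat) (x y : R.rig.obj (op d)) :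
    R.chiFun d (x + y) = R.chiFun d x ⊔ R.chiFun d y := by
  obtain ⟨ι, hι⟩ := R.isReallyLocal
  refine le_antisymm ?_ (sup_le ?_ ?_)
  · obtain ⟨c, hcd, hce, hc⟩ : ∃ (c : R.lat) (h : c ≤ d), c = (R.chiFun d (x + y) : R.lat) ∧
        R.rig.res h (x + y) = 1 :=
      ⟨_, (R.chiFun d (x + y)).2, rfl, (R.le_chiFun (x + y) (R.chiFun d (x + y)).2).1 le_rfl⟩
    change (R.chiFun d (x + y) : R.lat) ≤ (R.chiFun d x : R.lat) ⊔ (R.chiFun d y : R.lat)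
    rw [← hce]
    have key : ∀ z : R.rig.obj (op d), ∀ b : R.lat, ∀ f : b ⟶ c,
        (ι.app (op c) (R.rig.res hcd z) : ClosedSieve c).1 f →
          b ≤ (R.chiFun d z : R.lat) := by
      intro z b f hf
      refine (R.le_chiFun z ((leOfHom f).trans hcd)).2 ((IRig.isUnit_iff _ _).1 (hι _ _ ?_))
      rw [IRig.isUnit_iff]
      have e : R.rig.res ((leOfHom f).trans hcd) z = R.rig.map f.op (R.rig.res hcd z) := by
        rw [← IRig.comp_apply', ← R.rig.map_comp]
        rfl
      have n : ι.app (op b) (R.rig.map f.op (R.rig.res hcd z)) =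
          (omegaRig R.lat).map f.op (ι.app (op c) (R.rig.res hcd z)) :=
        congrArg (fun k : R.rig.obj (op c) ⟶ (omegaRig R.lat).obj (op b) => k (R.rig.res hcd z))
          (ι.naturality f.op)
      rw [e, n]
      exact Subtype.ext (Sieve.pullback_eq_top_of_mem _ hf)
    have h' := congrArg (ι.app (op c)) hc
    rw [map_add, map_add, map_one] at h'
    have h'' : (coherentCoverage R.lat).close
        ((ι.app (op c) (R.rig.res hcd x) : ClosedSieve c).1 ⊔
          (ι.app (op c) (R.rig.res hcd y) : ClosedSieve c).1) = ⊤ :=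
      congrArg Subtype.val h'
    rw [GrothendieckTopology.close_eq_top_iff_mem] at h''
    obtain ⟨t, ht, hS⟩ := h''
    refine ht.ge.trans (Finset.sup_le fun b hb => ?_)
    obtain ⟨f, hf⟩ := hS b hb
    rcases hf with hf | hf
    · exact (key x b f hf).trans le_sup_left
    · exact (key y b f hf).trans le_sup_right
  · refine (R.le_chiFun (x + y) (R.chiFun d x).2).2 ?_
    rw [map_add, (R.le_chiFun x (R.chiFun d x).2).1 le_rfl]
    exact IRig.one_add _ _
  · refine (R.le_chiFun (x + y) (R.chiFun d y).2).2 ?_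
    rw [map_add, (R.le_chiFun y (R.chiFun d y).2).1 le_rfl, add_comm]
    exact IRig.one_add _ _

/-- The (unique) local morphism of rigs `χ : X ⟶ Λ`, the characteristic map of the principal
subobject `1 : 1 ⟶ X`. It sends `x ∈ X d` to the largest `c ≤ d` such that `x · c = 1`. -/
noncomputable def chi : R.rig ⟶ lambdaRig R.lat where
  app d := ⟨{ toFun := R.chiFun d.unop
              map_one' := R.chiFun_one d.unop
              map_mul' := R.chiFun_mul d.unop
              map_zero' := R.chiFun_zero d.unop
              map_add' := R.chiFun_add d.unop }⟩
  naturality {d e} f := by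
    ext x
    refine iic_ext (d := e.unop) fun c h => ?_
    have hed : e.unop ≤ d.unop := leOfHom f.unop
    change c ≤ (R.chiFun e.unop (R.rig.map f x) : R.lat) ↔
      c ≤ (R.chiFun d.unop x : R.lat) ⊓ e.unop
    rw [le_inf_iff, le_chiFun _ _ h, le_chiFun _ _ (h.trans hed), ← IRig.comp_apply',
      ← R.rig.map_comp]
    exact ⟨fun k => ⟨k, h⟩, fun k => k.1⟩

theorem chi_isLocal : IsLocalMorphism R.chi := by
  intro d x hx
  rw [IRig.isUnit_iff] at hx ⊢
  have h : R.chiFun d x = ⊤ := hx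
  have h' : d ≤ (R.chiFun d x : R.lat) := by
    rw [h]
    exact le_rfl
  have h'' := (R.le_chiFun x le_rfl).1 h'
  have e : R.rig.res (le_refl d) = 𝟙 _ := R.rig.map_id (op d)
  rwa [e] at h''

end RigRep

/-! ### The category of representations -/

/-- The monotone map underlying a morphism of distributive lattices, as a functor. -/
abbrev latFunctor {D E : BddDistLat.{u}} (f : D ⟶ E) : (D : Type u) ⥤ (E : Type u) :=
  Monotone.functor (f := fun d : D => f d) (OrderHomClass.mono f.hom)

/-- The direct image functor `f_*`, which sends `Y` to the composite of `fᵒᵖ` and `Y`. -/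
abbrev directImage {D E : BddDistLat.{u}} (f : D ⟶ E) : RigPresheaf E ⥤ RigPresheaf D :=
  (Functor.whiskeringLeft _ _ _).obj (latFunctor f).op

/-- The morphism `Λ_D ⟶ f_* Λ_E` induced by `f : D ⟶ E`; it sends `a ≤ d` to `f a ≤ f d`. -/
def lambdaMap {D E : BddDistLat.{u}} (f : D ⟶ E) :
    lambdaRig D ⟶ (directImage f).obj (lambdaRig E) where
  app d := dLatToIRig.map (BddDistLat.ofHom
    { toFun := fun a : Set.Iic d.unop =>
        (⟨f a, OrderHomClass.mono f.hom a.2⟩ : Set.Iic ((latFunctor f).obj d.unop))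
      map_sup' := fun a b => Subtype.ext (map_sup f.hom (a : D) (b : D))
      map_inf' := fun a b => Subtype.ext (map_inf f.hom (a : D) (b : D))
      map_top' := Subtype.ext rfl
      map_bot' := Subtype.ext (map_bot f.hom) })
  naturality {d c} h := by
    refine IRig.hom_ext fun (a : Set.Iic d.unop) => ?_
    exact Subtype.ext (map_inf f.hom (a : D) c.unop)

namespace RigRep

/-- A map `(D, X) ⟶ (E, Y)` of representations: morphisms `f : D ⟶ E` of lattices and
`φ : X ⟶ f_* Y` of rigs, compatible with the morphisms `χ`. -/
structure Hom (R S : RigRep.{u}) where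
  /-- The morphism `f : D ⟶ E`. -/
  base : R.lat ⟶ S.lat
  /-- The morphism `φ : X ⟶ f_* Y`. -/
  map : R.rig ⟶ (directImage base).obj S.rig
  comm : map ≫ (directImage base).map S.chi = R.chi ≫ lambdaMap base

/-- The category `𝔍` of representations: the identity of `(D, X)` is `(id, id)`, and the composite
of `(g, γ)` and `(f, φ)` is `(f g, (g_* φ) γ)`. -/
instance : Category RigRep.{u} where
  Hom := Hom
  id R :=
    { base := 𝟙 R.lat
      map := { app := fun d => 𝟙 (R.rig.obj d) }
      comm := by
        ext d x
        rfl }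
  comp {R S T} G F :=
    { base := G.base ≫ F.base
      map := G.map ≫ (directImage G.base).map F.map
      comm := by
        ext d x
        have h1 := congrArg (fun k => k.app d x) G.comm
        have h2 := congrArg (fun k => k.app (op (G.base d.unop)) (G.map.app d x)) F.comm
        exact h2.trans (congrArg ((lambdaMap F.base).app (op (G.base d.unop))) h1) }
  id_comp F := rfl
  comp_id F := rfl
  assoc F G H := rfl

/-- The functor `(D, X) ↦ D` from representations to distributive lattices. -/
def lattice : RigRep.{u} ⥤ BddDistLat.{u} where
  obj R := R.lat
  map F := F.base

/-- The global sections functor `Γ : 𝔍 ⥤ iRig`, with `Γ (D, X) = X ⊤` and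
`Γ (f, φ) = φ_⊤ : X ⊤ ⟶ Y (f ⊤) = Y ⊤`. -/
def Γ : RigRep.{u} ⥤ IRig.{u} where
  obj R := R.rig.obj (op ⊤)
  map {R S} F := F.map.app (op ⊤) ≫ S.rig.res (map_top F.base.hom).ge
  map_id R := R.rig.map_id _
  map_comp {R S T} F G := by
    refine IRig.hom_ext fun x => ?_
    have h := congrArg (fun k => k (F.map.app (op ⊤) x))
      (G.map.naturality (homOfLE (map_top F.base.hom).ge).op)
    have h' := congrArg (T.rig.res (map_top G.base.hom).ge) h
    refine Eq.trans ?_ h'.symm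
    exact congrArg (fun k => k (G.map.app (op (F.base ⊤)) (F.map.app (op ⊤) x)))
      (T.rig.map_comp ((latFunctor G.base).map (homOfLE (map_top F.base.hom).ge)).op
        (homOfLE (map_top G.base.hom).ge).op)

end RigRep

/-! ### The order of an integral rig and its quotients -/

namespace IRig

section Order

variable {A : IRig.{u}}

/-! An integral rig is ordered by `a + b = b`, with top element `1`. Inverting an element means
making it `1`, so both universal constructions are quotients of `A` by a coarser preorder. The
reticulation uses "`a ^ n ≤ b` for some `n`". The sections over `d` use "`z * a ≤ b` for some `z`
with `d ≤ eta z`". Every section over `d` is therefore the germ of an element of `A`. Over `⊤` the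
only multiplier is `1`, so the global sections are `A` itself.

The sheaf condition rests on two computations with multipliers. Sums of multipliers give
separatedness (`locPreorder_sup_rel`), and a compatible finite family is glued by a sum weighted by
a large common power (`exists_germ_eq`). The structure sheaf is really local because `eta` induces a
local morphism to `Λ`, and `Λ` maps locally to `Ω` by principal sieves.

For the adjunction, let `g` map `A` to the global sections of a representation. Composing `g` with
`χ` at `⊤` gives a lattice map out of the reticulation. If `d ≤ eta z`, then `g z` restricts to `1`
over the image of `d`, so restricting `g` factors through the germs at `d`
(`res_mono_of_locPreorder`). Compatibility with `χ` and surjectivity of germs leave no other choice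
(`rep_hom_ext`). The unit is `germ ⊤`, an isomorphism, so the left adjoint is full and faithful. -/

theorem add_self_eq (x : A) : x + x = x := by
  have h := congrArg (x * ·) (A.one_add 1)
  simpa only [mul_add, mul_one] using h

/-- The canonical order of an integral rig: `a ≤ b` if and only if `a + b = b`. -/
instance : PartialOrder A where
  le a b := a + b = b
  le_refl := add_self_eq
  le_trans a b c h₁ h₂ := by
    rw [← show b + c = c from h₂, ← add_assoc, show a + b = b from h₁]
  le_antisymm a b h₁ h₂ := by
    rw [← show a + b = b from h₁, add_comm]
    exact (show b + a = a from h₂).symm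

theorem le_iff_add_eq {a b : A} : a ≤ b ↔ a + b = b := Iff.rfl

theorem le_one (a : A) : a ≤ 1 := by
  rw [le_iff_add_eq, add_comm, A.one_add]

theorem one_le_iff {a : A} : 1 ≤ a ↔ a = 1 := by
  rw [le_iff_add_eq, A.one_add, eq_comm]

instance : IsOrderedRing A where
  add_le_add_left a b h c := by
    rw [le_iff_add_eq] at h ⊢
    rw [add_add_add_comm, h, add_self_eq]
  zero_le_one := zero_add 1
  mul_le_mul_of_nonneg_left a _ b c h := by
    change a * b + a * c = a * c
    rw [← mul_add, le_iff_add_eq.1 h]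
  mul_le_mul_of_nonneg_right a _ b c h := by
    change b * a + c * a = c * a
    rw [← add_mul, le_iff_add_eq.1 h]

instance : CanonicallyOrderedAdd A where
  exists_add_of_le {a b} h := ⟨b, h.symm⟩
  le_add_self a b := by rw [le_iff_add_eq, add_left_comm, add_self_eq]
  le_self_add a b := by rw [le_iff_add_eq, ← add_assoc, add_self_eq]

theorem add_le_of_le {a b c : A} (ha : a ≤ c) (hb : b ≤ c) : a + b ≤ c :=
  (add_le_add ha hb).trans_eq (add_self_eq c)

theorem sum_le_of_forall_le {ι : Type*} (s : Finset ι) {f : ι → A} {c : A}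
    (h : ∀ i ∈ s, f i ≤ c) : ∑ i ∈ s, f i ≤ c :=
  Finset.sum_induction f (· ≤ c) (fun _ _ => add_le_of_le) (zero_le : (0 : A) ≤ c) h

theorem mul_le_left (a b : A) : a * b ≤ a :=
  (mul_le_mul_right (le_one b) a).trans_eq (mul_one a)

theorem mul_le_right (a b : A) : a * b ≤ b :=
  (mul_comm a b).trans_le (mul_le_left b a)

theorem pow_le_pow_of_le (a : A) {m n : ℕ} (h : m ≤ n) : a ^ n ≤ a ^ m := by
  rw [← Nat.add_sub_of_le h, pow_add]
  exact mul_le_left _ _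

theorem hom_mono {B : IRig.{u}} (f : A ⟶ B) {a b : A} (h : a ≤ b) : f a ≤ f b := by
  rw [le_iff_add_eq] at h ⊢
  rw [← map_add, h]

end Order

/-! ### Quotients of integral rigs by preorders -/

/-- A preorder on an integral rig, coarser than the canonical one, whose associated quotient is
again an integral rig. -/
structure RigPreorder (A : IRig.{u}) where
  /-- The relation. -/
  rel : A → A → Prop
  of_le : ∀ {a b}, a ≤ b → rel a b
  trans : ∀ {a b c}, rel a b → rel b c → rel a c
  add_rel : ∀ {a b c}, rel a c → rel b c → rel (a + b) c
  mul_rel : ∀ {a b} (c), rel a b → rel (a * c) (b * c)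

namespace RigPreorder

variable {A : IRig.{u}} (r : RigPreorder A)

/-- The congruence of the elements that are equivalent for the preorder. -/
def con : RingCon A where
  r a b := r.rel a b ∧ r.rel b a
  iseqv :=
    { refl := fun _ => ⟨r.of_le le_rfl, r.of_le le_rfl⟩
      symm := fun h => ⟨h.2, h.1⟩
      trans := fun h k => ⟨r.trans h.1 k.1, r.trans k.2 h.2⟩ }
  add' := by
    have key : ∀ {a b c d}, r.rel a b → r.rel c d → r.rel (a + c) (b + d) := fun h k =>
      r.add_rel (r.trans h (r.of_le le_self_add)) (r.trans k (r.of_le le_add_self))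
    exact fun {_ _ _ _} h k => ⟨key h.1 k.1, key h.2 k.2⟩
  mul' := by
    have key : ∀ {a b c d}, r.rel a b → r.rel c d → r.rel (a * c) (b * d) := by
      intro a b c d h k
      refine r.trans (r.mul_rel c h) ?_
      rw [mul_comm b, mul_comm b]
      exact r.mul_rel b k
    exact fun {_ _ _ _} h k => ⟨key h.1 k.1, key h.2 k.2⟩

/-- The quotient of an integral rig by a rig preorder. -/
def quot : IRig.{u} where
  carrier := r.con.Quotient
  one_add := by
    rintro ⟨x⟩
    exact congrArg r.con.mk' (A.one_add x)

/-- The projection to the quotient. -/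
def proj : A ⟶ r.quot := ⟨r.con.mk'⟩

theorem proj_surjective : Function.Surjective r.proj := r.con.mk'_surjective

theorem proj_eq_proj {a b : A} : r.proj a = r.proj b ↔ r.rel a b ∧ r.rel b a :=
  r.con.eq

theorem proj_le_proj {a b : A} : r.proj a ≤ r.proj b ↔ r.rel a b := by
  rw [le_iff_add_eq, ← map_add, proj_eq_proj]
  exact ⟨fun h => r.trans (r.of_le le_self_add) h.1,
    fun h => ⟨r.add_rel h (r.of_le le_rfl), r.of_le le_add_self⟩⟩

theorem proj_eq_one {a : A} : r.proj a = 1 ↔ r.rel 1 a := by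
  rw [← one_le_iff, ← map_one r.proj.hom]
  exact r.proj_le_proj

variable {r} {B : IRig.{u}}

/-- The factorization through the quotient of a morphism that is monotone for the preorder. -/
def lift (g : A ⟶ B) (h : ∀ a b, r.rel a b → g a ≤ g b) : r.quot ⟶ B :=
  ⟨r.con.lift g.hom fun {a b} hab => le_antisymm (h a b hab.1) (h b a hab.2)⟩

theorem quot_hom_ext {f g : r.quot ⟶ B} (h : ∀ a, f (r.proj a) = g (r.proj a)) : f = g :=
  hom_ext fun x => by
    obtain ⟨a, rfl⟩ := r.proj_surjective x
    exact h a

end RigPreorder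

/-- An integral rig with idempotent multiplication is a distributive lattice. -/
abbrev distribLatticeOfIdempotent (B : IRig.{u}) (h : ∀ x : B, x * x = x) : DistribLattice B where
  sup a b := a + b
  le_sup_left _ _ := le_self_add
  le_sup_right _ _ := le_add_self
  sup_le _ _ _ := add_le_of_le
  inf a b := a * b
  inf_le_left := mul_le_left
  inf_le_right := mul_le_right
  le_inf a b c hb hc := (h a).ge.trans (mul_le_mul' hb hc)
  le_sup_inf a b c := by
    change (a + b) * (a + c) ≤ a + b * c
    rw [add_mul, mul_add b]
    exact add_le_of_le ((mul_le_left _ _).trans le_self_add)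
      (add_le_add_left (mul_le_right b a) _)

/-- The bounded distributive lattice underlying an integral rig with idempotent multiplication. -/
abbrev latOfIdempotent (B : IRig.{u}) (h : ∀ x : B, x * x = x) : BddDistLat.{u} :=
  letI := distribLatticeOfIdempotent B h
  letI : BoundedOrder B :=
    { top := 1
      le_top := le_one
      bot := 0
      bot_le := fun _ => zero_le }
  BddDistLat.of B

/-! ### The reticulation -/

variable (A : IRig.{u})

/-- The preorder in which `a` is below `b` if and only if `aⁿ ≤ b` for some `n`. -/
def radPreorder : RigPreorder A where
  rel a b := ∃ n : ℕ, a ^ n ≤ b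
  of_le h := ⟨1, by rwa [pow_one]⟩
  trans := by
    rintro a b c ⟨n, hn⟩ ⟨m, hm⟩
    exact ⟨n * m, by rw [pow_mul]; exact (pow_le_pow_left' hn m).trans hm⟩
  add_rel := by
    rintro a b c ⟨n, hn⟩ ⟨m, hm⟩
    -- In each term of the binomial expansion, the exponent of `a` is at least `n` or that of `b` is
    -- at least `m`.
    refine ⟨n + m, ?_⟩
    rw [add_pow]
    refine sum_le_of_forall_le _ fun k _ => (mul_le_left _ _).trans ?_
    rcases le_total n k with h | h
    · exact (mul_le_left _ _).trans ((pow_le_pow_of_le a h).trans hn)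
    · exact (mul_le_right _ _).trans ((pow_le_pow_of_le b (by omega)).trans hm)
  mul_rel := by
    rintro a b c ⟨n, hn⟩
    -- The extra factor keeps the power of `c` below `c` even when `n = 0`.
    refine ⟨n + 1, ?_⟩
    rw [mul_pow]
    refine mul_le_mul' ((pow_le_pow_of_le a n.le_succ).trans hn) ?_
    rw [pow_succ]
    exact mul_le_right _ _

theorem radPreorder_idempotent (x : A.radPreorder.quot) : x * x = x := by
  obtain ⟨a, rfl⟩ := A.radPreorder.proj_surjective x
  rw [← map_mul, RigPreorder.proj_eq_proj]
  exact ⟨A.radPreorder.of_le (mul_le_left a a), 2, (sq a).le⟩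

/-- The reticulation of an integral rig. -/
def reticulation : BddDistLat.{u} := latOfIdempotent _ A.radPreorder_idempotent

/-- The universal morphism from an integral rig to its reticulation. -/
def toRet : A ⟶ dLatToIRig.obj A.reticulation :=
  ⟨{ toFun := fun a => A.radPreorder.proj a
     map_one' := rfl
     map_mul' := fun _ _ => rfl
     map_zero' := rfl
     map_add' := fun _ _ => rfl }⟩

variable {A}

/-- The element of the reticulation given by an element of the integral rig. -/
def eta (a : A) : A.reticulation := A.toRet a

theorem eta_surjective : Function.Surjective (eta : A → A.reticulation) :=
  A.radPreorder.proj_surjective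

theorem eta_le_eta {a b : A} : eta a ≤ eta b ↔ ∃ n : ℕ, a ^ n ≤ b :=
  A.radPreorder.proj_le_proj

theorem eta_mono {a b : A} (h : a ≤ b) : eta a ≤ eta b := eta_le_eta.2 (A.radPreorder.of_le h)

@[simp]
theorem eta_one : eta (1 : A) = ⊤ := rfl

@[simp]
theorem eta_mul (a b : A) : eta (a * b) = eta a ⊓ eta b := rfl

@[simp]
theorem eta_add (a b : A) : eta (a + b) = eta a ⊔ eta b := rfl

theorem eta_pow_le (a : A) (n : ℕ) : eta a ≤ eta (a ^ n) := eta_le_eta.2 ⟨n, le_rfl⟩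

/-- All powers of `1` are `1`, and `1` is the largest element. This is what prevents localization at
`⊤` from identifying anything. -/
theorem eta_eq_top {a : A} : eta a = ⊤ ↔ a = 1 := by
  rw [← top_le_iff, ← eta_one, eta_le_eta]
  simp only [one_pow, exists_const, one_le_iff]

theorem le_pow_of_idempotent {x : A} (h : x * x = x) (n : ℕ) : x ≤ x ^ n := by
  induction n with
  | zero => exact (le_one x).trans_eq (pow_zero x).symm
  | succ n ih =>
    rw [pow_succ]
    exact h.ge.trans (mul_le_mul_left ih x)

/-- Elements of a lattice are idempotent, so passing to a power of `g a` loses nothing. -/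
theorem map_le_of_radPreorder {M : BddDistLat.{u}} (g : A ⟶ dLatToIRig.obj M) (a b : A)
    (h : A.radPreorder.rel a b) : g a ≤ g b := by
  obtain ⟨n, hn⟩ := h
  refine (le_pow_of_idempotent ?_ n).trans ((map_pow g.hom a n).ge.trans (hom_mono g hn))
  exact inf_idem (α := M) (g a)

/-- The factorization through the reticulation of a morphism to a distributive lattice. -/
def retLift {M : BddDistLat.{u}} (g : A ⟶ dLatToIRig.obj M) : A.reticulation ⟶ M :=
  BddDistLat.ofHom (X := A.reticulation) (Y := M)
    { toFun := RigPreorder.lift g (map_le_of_radPreorder g)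
      map_sup' := map_add (RigPreorder.lift g (map_le_of_radPreorder g)).hom
      map_inf' := map_mul (RigPreorder.lift g (map_le_of_radPreorder g)).hom
      map_top' := map_one (RigPreorder.lift g (map_le_of_radPreorder g)).hom
      map_bot' := map_zero (RigPreorder.lift g (map_le_of_radPreorder g)).hom }

theorem ret_hom_ext {M : BddDistLat.{u}} {f g : A.reticulation ⟶ M}
    (h : ∀ a : A, f (eta a) = g (eta a)) : f = g :=
  BddDistLat.ext fun x => by
    obtain ⟨a, rfl⟩ := eta_surjective x
    exact h a

end IRig

theorem latticeRig_le_iff {L : Type u} [DistribLattice L] [BoundedOrder L] {a b : latticeRig L} :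
    a ≤ b ↔ @LE.le L _ a b :=
  sup_eq_right (α := L)

/-! ### The structure sheaf of an integral rig -/

namespace IRig

variable {A : IRig.{u}}

/-- The preorder in which `a` is below `b` if and only if `z * a ≤ b` for some `z` with
`d ≤ eta z`; the quotient by it is the localization at the elements `z` with `d ≤ eta z`. -/
def locPreorder (d : A.reticulation) : RigPreorder A where
  rel a b := ∃ z : A, d ≤ eta z ∧ z * a ≤ b
  of_le h := ⟨1, le_top, (mul_le_right _ _).trans h⟩
  trans := by
    rintro a b c ⟨z, hz, h⟩ ⟨w, hw, k⟩
    exact ⟨w * z, le_inf hw hz, by rw [mul_assoc]; exact (mul_le_mul_right h w).trans k⟩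
  add_rel := by
    rintro a b c ⟨z, hz, h⟩ ⟨w, hw, k⟩
    refine ⟨z * w, le_inf hz hw, ?_⟩
    rw [mul_add]
    exact add_le_of_le ((mul_le_mul_left (mul_le_left z w) a).trans h)
      ((mul_le_mul_left (mul_le_right z w) b).trans k)
  mul_rel := by
    rintro a b c ⟨z, hz, h⟩
    exact ⟨z, hz, by rw [← mul_assoc]; exact mul_le_mul_left h c⟩

theorem locPreorder_anti {c d : A.reticulation} (h : c ≤ d) {a b : A}
    (hab : (locPreorder d).rel a b) : (locPreorder c).rel a b := by
  obtain ⟨z, hz, hz'⟩ := hab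
  exact ⟨z, h.trans hz, hz'⟩

/-- A multiplier witnessing the relation lies below `a`; conversely `a` can be its own multiplier.
-/
theorem locPreorder_one_rel {d : A.reticulation} {a : A} :
    (locPreorder d).rel 1 a ↔ d ≤ eta a := by
  constructor
  · rintro ⟨z, hz, h⟩
    rw [mul_one] at h
    exact hz.trans (eta_mono h)
  · exact fun h => ⟨a, h, (mul_one a).le⟩

theorem locPreorder_top_rel {a b : A} : (locPreorder (⊤ : A.reticulation)).rel a b ↔ a ≤ b := by
  constructor
  · rintro ⟨z, hz, h⟩
    rwa [eta_eq_top.1 (top_le_iff.1 hz), one_mul] at h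
  · exact (locPreorder _).of_le

/-- Multipliers for the pieces add up to a multiplier for the join, because `eta` turns sums into
joins. This is the separatedness of the structure sheaf. -/
theorem locPreorder_sup_rel {ι : Type*} (s : Finset ι) (f : ι → A.reticulation) {a b : A}
    (h : ∀ i ∈ s, (locPreorder (f i)).rel a b) : (locPreorder (s.sup f)).rel a b := by
  classical
  induction s using Finset.induction_on with
  -- Over `⊥` even `0` is an admissible multiplier, so all elements become related.
  | empty => exact ⟨0, bot_le, by rw [zero_mul]; exact zero_le⟩
  | insert i s _ ih =>
    obtain ⟨z, hz, hza⟩ := h i (Finset.mem_insert_self i s)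
    obtain ⟨w, hw, hwa⟩ := ih fun j hj => h j (Finset.mem_insert_of_mem hj)
    refine ⟨z + w, ?_, by rw [add_mul]; exact add_le_of_le hza hwa⟩
    rw [Finset.sup_insert, eta_add]
    exact sup_le_sup hz hw

variable (A) in
/-- The structure sheaf of an integral rig on its reticulation. -/
def structureSheaf : RigPresheaf A.reticulation where
  obj d := (locPreorder d.unop).quot
  map {_ c} f := RigPreorder.lift (locPreorder c.unop).proj fun _ _ h =>
    (RigPreorder.proj_le_proj _).2 (locPreorder_anti (leOfHom f.unop) h)
  map_id _ := RigPreorder.quot_hom_ext fun _ => rfl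
  map_comp _ _ := RigPreorder.quot_hom_ext fun _ => rfl

/-- The section over `d` of the structure sheaf that is given by an element of the rig. -/
def germ (d : A.reticulation) : A ⟶ A.structureSheaf.obj (op d) := (locPreorder d).proj

theorem germ_surjective (d : A.reticulation) : Function.Surjective (germ d) :=
  (locPreorder d).proj_surjective

theorem germ_eq_germ {d : A.reticulation} {a b : A} :
    germ d a = germ d b ↔ (locPreorder d).rel a b ∧ (locPreorder d).rel b a :=
  (locPreorder d).proj_eq_proj

theorem germ_eq_one {d : A.reticulation} {a : A} : germ d a = 1 ↔ d ≤ eta a :=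
  ((locPreorder d).proj_eq_one).trans locPreorder_one_rel

theorem germ_top_injective : Function.Injective (germ (⊤ : A.reticulation)) := by
  intro a b h
  rw [germ_eq_germ, locPreorder_top_rel, locPreorder_top_rel] at h
  exact le_antisymm h.1 h.2

theorem germ_sup_eq {ι : Type*} (s : Finset ι) (f : ι → A.reticulation) {a b : A}
    (h : ∀ i ∈ s, germ (f i) a = germ (f i) b) : germ (s.sup f) a = germ (s.sup f) b :=
  germ_eq_germ.2 ⟨locPreorder_sup_rel s f fun i hi => (germ_eq_germ.1 (h i hi)).1,
    locPreorder_sup_rel s f fun i hi => (germ_eq_germ.1 (h i hi)).2⟩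

/-! ### Gluing and the sheaf condition -/

/-- Sections over finitely many elements that agree on binary meets can be glued. -/
theorem exists_germ_eq (t : Finset A.reticulation) (a : A.reticulation → A)
    (h : ∀ c ∈ t, ∀ c' ∈ t, germ (c ⊓ c') (a c) = germ (c ⊓ c') (a c')) :
    ∃ b : A, ∀ c ∈ t, germ c b = germ c (a c) := by
  choose e he using eta_surjective (A := A)
  -- A multiplier on `c ⊓ c'` dominates a power of `e c * e c'`, which can replace it.
  have key : ∀ c c', ∃ n : ℕ, c ∈ t → c' ∈ t → (e c * e c') ^ n * a c ≤ a c' := by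
    intro c c'
    by_cases hc : c ∈ t ∧ c' ∈ t
    · obtain ⟨z, hz, hz'⟩ := (germ_eq_germ.1 (h c hc.1 c' hc.2)).1
      rw [← he c, ← he c', ← eta_mul, eta_le_eta] at hz
      obtain ⟨n, hn⟩ := hz
      exact ⟨n, fun _ _ => (mul_le_mul_left hn _).trans hz'⟩
    · exact ⟨0, fun h₁ h₂ => (hc ⟨h₁, h₂⟩).elim⟩
  choose n hn using key
  obtain ⟨N, hN⟩ : ∃ N : ℕ, ∀ c ∈ t, ∀ c' ∈ t, n c c' ≤ N :=
    ⟨t.sup fun c => t.sup (n c), fun c hc c' hc' =>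
      (Finset.le_sup (f := n c) hc').trans (Finset.le_sup (f := fun c => t.sup (n c)) hc)⟩
  -- Multiplying this sum by `e c ^ N` turns the weights into powers of `e c' * e c`, which bring
  -- each term below `a c`. Conversely, `e c ^ N * a c` is itself a term of the sum.
  refine ⟨∑ c ∈ t, e c ^ N * a c, fun c hc => ?_⟩
  have hcN : c ≤ eta (e c ^ N) := (he c).ge.trans (eta_pow_le _ N)
  refine germ_eq_germ.2 ⟨⟨e c ^ N, hcN, ?_⟩, ⟨e c ^ N, hcN, ?_⟩⟩
  · rw [Finset.mul_sum]
    refine sum_le_of_forall_le _ fun c' hc' => ?_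
    rw [← mul_assoc, ← mul_pow, mul_comm (e c)]
    exact (mul_le_mul_left (pow_le_pow_of_le _ (hN c' hc' c hc)) _).trans (hn c' c hc' hc)
  · exact Finset.single_le_sum (f := fun c => e c ^ N * a c) (fun _ _ => zero_le) hc

/-- All sections lift to `A`, so it suffices to glue over the finite family `t` inside the sieve.
The other members of the sieve are then handled through their meets with `t`. -/
theorem structureSheaf_isSheaf : IsSheafOfRigs A.structureSheaf := by
  rintro d S ⟨t, ht, hS⟩ x hx
  have hcompat : ∀ {c c' : A.reticulation} (f : c ⟶ d) (f' : c' ⟶ d) (hf : S f) (hf' : S f')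
      (a a' : A), x f hf = germ c a → x f' hf' = germ c' a' →
      germ (c ⊓ c') a = germ (c ⊓ c') a' := by
    intro c c' f f' hf hf' a a' ha ha'
    have h := hx (homOfLE inf_le_left : c ⊓ c' ⟶ c) (homOfLE inf_le_right : c ⊓ c' ⟶ c') hf hf'
      (Subsingleton.elim _ _)
    rw [ha, ha'] at h
    exact h
  -- Arrows `c ⟶ d` are unique, so one representative per `c` suffices; `0` is a dummy value off the
  -- sieve.
  have hex : ∀ c, ∃ a : A, ∀ (f : c ⟶ d) (hf : S f), x f hf = germ c a := by
    intro c
    by_cases h : ∃ f : c ⟶ d, S f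
    · obtain ⟨f, hf⟩ := h
      obtain ⟨a, ha⟩ := germ_surjective c (x f hf)
      exact ⟨a, fun f' _ => Subsingleton.elim f f' ▸ ha.symm⟩
    · exact ⟨0, fun f hf => (h ⟨f, hf⟩).elim⟩
  choose a ha using hex
  obtain ⟨b, hb⟩ := exists_germ_eq t a fun c hc c' hc' => by
    obtain ⟨f, hf⟩ := hS c hc
    obtain ⟨f', hf'⟩ := hS c' hc'
    exact hcompat f f' hf hf' _ _ (ha c f hf) (ha c' f' hf')
  have hcover : ∀ c ≤ d, t.sup (fun c' => c ⊓ c') = c := fun c hc => by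
    have h := Finset.sup_inf_distrib_left t id c
    rw [ht, inf_eq_left.2 hc] at h
    exact h.symm
  refine ⟨germ d b, fun c f hf => ?_, fun y hy => ?_⟩
  · refine Eq.trans ?_ (ha c f hf).symm
    change germ c b = germ c (a c)
    -- Agreement over `c` is tested on the cover of `c` by the meets `c ⊓ c'` with `c' ∈ t`, where
    -- `b` represents the given section by construction.
    rw [← hcover c (leOfHom f)]
    refine germ_sup_eq t _ fun c' hc' => ?_
    rw [hcover c (leOfHom f)]
    obtain ⟨f', hf'⟩ := hS c' hc'
    rw [hcompat f f' hf hf' _ _ (ha c f hf) (ha c' f' hf')]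
    exact congrArg (A.structureSheaf.res inf_le_right) (hb c' hc')
  · obtain ⟨b', rfl⟩ := germ_surjective d y
    rw [← ht]
    refine germ_sup_eq t id fun c hc => ?_
    obtain ⟨f, hf⟩ := hS c hc
    exact ((hy f hf).trans (ha c f hf)).trans (hb c hc).symm

/-- The morphism from the structure sheaf to `Λ` induced by `eta`. -/
def structureSheafToLambda : A.structureSheaf ⟶ lambdaRig A.reticulation where
  app d := RigPreorder.lift (B := (lambdaRig A.reticulation).obj d)
    ⟨{ toFun := fun a => (⟨eta a ⊓ d.unop, Set.mem_Iic.2 inf_le_right⟩ : Set.Iic d.unop)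
       map_one' := Subtype.ext (top_inf_eq _)
       map_mul' := fun a b => Subtype.ext (inf_inf_distrib_right (eta a) (eta b) d.unop)
       map_zero' := Subtype.ext (bot_inf_eq _)
       map_add' := fun a b => Subtype.ext (inf_sup_right (eta a) (eta b) d.unop) }⟩ <| by
    rintro a b ⟨z, hz, h⟩
    refine latticeRig_le_iff.2 (le_inf ?_ inf_le_right : eta a ⊓ d.unop ≤ eta b ⊓ d.unop)
    -- Below `d` the multiplier is invisible: `eta a ⊓ d` lies under `eta z ⊓ eta a`, which is `eta
    -- (z * a)`.
    exact (le_inf (inf_le_right.trans hz) inf_le_left).trans (eta_mono h)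
  naturality {d c} f := RigPreorder.quot_hom_ext fun a => Subtype.ext <| by
    change eta a ⊓ c.unop = eta a ⊓ d.unop ⊓ c.unop
    rw [inf_assoc, inf_eq_right.2 (leOfHom f.unop)]

theorem structureSheafToLambda_isLocal : IsLocalMorphism (structureSheafToLambda (A := A)) := by
  intro d x hx
  obtain ⟨a, rfl⟩ := germ_surjective d x
  rw [isUnit_iff] at hx ⊢
  have h : eta a ⊓ d = d := congrArg (fun y : Set.Iic d => (y : A.reticulation)) hx
  exact germ_eq_one.2 (inf_eq_right.1 h)

theorem unitSubobject_structureSheaf_isPrincipal :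
    IsPrincipal (unitSubobject A.structureSheaf) := by
  intro d x
  obtain ⟨a, rfl⟩ := germ_surjective d x
  refine ⟨eta a ⊓ d, ⟨inf_le_right, germ_eq_one.2 inf_le_left⟩, ?_⟩
  rintro c ⟨h, hc⟩
  exact le_inf (germ_eq_one.1 hc) h

end IRig

/-! ### The morphism from `Λ` to `Ω` -/

section LambdaToOmega

variable {D : BddDistLat.{u}}

/-- The principal sieve of the arrows whose domain is below `a`. -/
def principalSieve (d a : D) : ClosedSieve d where
  val :=
    { arrows := fun c _ => c ≤ a
      downward_closed := fun h g => (leOfHom g).trans h }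
  property := by
    rintro c f ⟨t, rfl, h⟩
    exact Finset.sup_le fun b hb => (h b hb).choose_spec

/-- Principal sieves form a sublattice of the lattice of closed sieves. -/
def principalSieveHom (d : D) : BoundedLatticeHom (Set.Iic d) (ClosedSieve d) where
  toFun a := principalSieve d a
  map_sup' a b := by
    classical
    refine le_antisymm ?_ (sup_le (α := ClosedSieve d) ?_ ?_)
    · intro c f (hf : c ≤ (a : D) ⊔ b)
      -- By distributivity these two elements cover `c`, and each lies in one of the two principal
      -- sieves.
      refine ⟨{c ⊓ a, c ⊓ b}, ?_, ?_⟩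
      · rw [Finset.sup_insert, Finset.sup_singleton]
        exact (inf_sup_left c (a : D) b).symm.trans (inf_eq_left.2 hf)
      · intro e he
        rcases Finset.mem_insert.1 he with rfl | he
        · exact ⟨homOfLE inf_le_left, Or.inl (inf_le_right : c ⊓ (a : D) ≤ a)⟩
        · obtain rfl := Finset.mem_singleton.1 he
          exact ⟨homOfLE inf_le_left, Or.inr (inf_le_right : c ⊓ (b : D) ≤ b)⟩
    · exact fun c f hf => le_trans (b := (a : D)) hf le_sup_left
    · exact fun c f hf => le_trans (b := (b : D)) hf le_sup_right
  map_inf' a b := Subtype.ext <| Sieve.ext fun c f => (le_inf_iff : c ≤ (a : D) ⊓ b ↔ _)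
  map_top' := top_le_iff.1 (show ⊤ ≤ principalSieve d d from fun _ f _ => leOfHom f)
  map_bot' := by
    refine le_bot_iff.1 (show principalSieve d ⊥ ≤ ⊥ from ?_)
    intro c f (hf : c ≤ ⊥)
    exact ⟨∅, (le_bot_iff.1 hf).symm, fun e he => (Finset.notMem_empty e he).elim⟩

variable (D) in
/-- The morphism from `Λ` to `Ω` that sends an element to its principal sieve. -/
def lambdaToOmega : lambdaRig D ⟶ omegaRig D where
  app d := dLatToIRig.map (BddDistLat.ofHom (principalSieveHom d.unop))
  naturality {d c} f := IRig.hom_ext fun (a : Set.Iic d.unop) => by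
    change principalSieve c.unop ((a : D) ⊓ c.unop) =
      ClosedSieve.pullback f.unop (principalSieve d.unop (a : D))
    refine Subtype.ext (Sieve.ext fun e g => ?_)
    exact ⟨fun h => le_trans h (inf_le_left : (a : D) ⊓ c.unop ≤ a),
      fun (h : e ≤ (a : D)) => (le_inf h (leOfHom g) : e ≤ (a : D) ⊓ c.unop)⟩

/-- A principal sieve is maximal only if it contains the identity of `d`, which forces `d ≤ a`. -/
theorem lambdaToOmega_isLocal : IsLocalMorphism (lambdaToOmega D) := by
  intro d (a : Set.Iic d) ha
  rw [IRig.isUnit_iff] at ha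
  have h : principalSieve d a = ⊤ := ha
  have h' : (⊤ : ClosedSieve d).1 (𝟙 d) := trivial
  rw [← h] at h'
  exact (IRig.isUnit_iff ((lambdaRig D).obj (op d)) _).2 (Subtype.ext (le_antisymm a.2 h'))

theorem isReallyLocal_of_toLambda {X : RigPresheaf D} (f : X ⟶ lambdaRig D)
    (hf : IsLocalMorphism f) : IsReallyLocal X :=
  ⟨f ≫ lambdaToOmega D, fun d x hx => hf d x (lambdaToOmega_isLocal d _ hx)⟩

end LambdaToOmega

/-- The representation of an integral rig on its reticulation. -/
def IRig.rep (A : IRig.{u}) : RigRep.{u} where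
  lat := A.reticulation
  rig := A.structureSheaf
  isSheaf := structureSheaf_isSheaf
  isReallyLocal := isReallyLocal_of_toLambda _ structureSheafToLambda_isLocal
  isPrincipal := unitSubobject_structureSheaf_isPrincipal

/-! ### The adjunction between representations and global sections -/

namespace RigPresheaf

variable {D : BddDistLat.{u}} (X : RigPresheaf D)

theorem res_res {b c d : D} (h : b ≤ c) (h' : c ≤ d) (x : X.obj (op d)) :
    X.res h (X.res h' x) = X.res (h.trans h') x := by
  rw [← IRig.comp_apply', ← X.map_comp]
  rfl

theorem res_self {d : D} (h : d ≤ d) (x : X.obj (op d)) : X.res h x = x :=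
  congrArg (fun k : X.obj (op d) ⟶ X.obj (op d) => k x) (X.map_id (op d))

end RigPresheaf

/-! ### Extents of sections -/

namespace RigRep

variable {R S : RigRep.{u}}

variable (R) in
/-- The largest element below `d` at which the section `x` is equal to `1`. -/
noncomputable def extent (d : R.lat) (x : R.rig.obj (op d)) : R.lat := (R.chiFun d x).1

theorem extent_le (d : R.lat) (x : R.rig.obj (op d)) : R.extent d x ≤ d := (R.chiFun d x).2

theorem extent_res {c d : R.lat} (h : c ≤ d) (x : R.rig.obj (op d)) :
    R.extent c (R.rig.res h x) = R.extent d x ⊓ c :=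
  congrArg Subtype.val (congrArg (fun k : R.rig.obj (op d) ⟶ (lambdaRig R.lat).obj (op c) =>
    (k x : Set.Iic c)) (R.chi.naturality (homOfLE h).op))

theorem res_map_app (F : R ⟶ S) {c d : R.lat} (h : c ≤ d) (x : R.rig.obj (op d)) :
    F.map.app (op c) (R.rig.res h x) =
      S.rig.res (OrderHomClass.mono F.base.hom h) (F.map.app (op d) x) :=
  congrArg (fun k : R.rig.obj (op d) ⟶ ((directImage F.base).obj S.rig).obj (op c) => k x)
    (F.map.naturality (homOfLE h).op)

theorem extent_map_app (F : R ⟶ S) (d : R.lat) (x : R.rig.obj (op d)) :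
    S.extent (F.base d) (F.map.app (op d) x) = F.base (R.extent d x) :=
  congrArg Subtype.val (congrArg (fun k : R.rig ⟶ (directImage F.base).obj (lambdaRig S.lat) =>
    (k.app (op d) x : Set.Iic (F.base d))) F.comm)

variable (R) in
/-- The morphism from the global sections to the lattice induced by `χ`. -/
noncomputable def chiTop : Γ.obj R ⟶ dLatToIRig.obj R.lat :=
  ⟨{ toFun := R.extent ⊤
     map_one' := congrArg Subtype.val (R.chiFun_one ⊤)
     map_mul' := fun x y => congrArg Subtype.val (R.chiFun_mul ⊤ x y)
     map_zero' := congrArg Subtype.val (R.chiFun_zero ⊤)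
     map_add' := fun x y => congrArg Subtype.val (R.chiFun_add ⊤ x y) }⟩

/-- Compatibility with `χ`, read on global sections. The restriction built into `Γ.map` does not
change the extent, since the base map preserves `⊤`. -/
theorem extent_Γ_map (F : R ⟶ S) (x : Γ.obj R) :
    S.extent ⊤ (Γ.map F x) = F.base (R.extent ⊤ x) :=
  ((extent_res _ _).trans (inf_eq_left.2 ((extent_le _ _).trans (map_top F.base.hom).le))).trans
    (extent_map_app F ⊤ x)

theorem map_app_res_top (F : R ⟶ S) (d : R.lat) (x : Γ.obj R) :
    F.map.app (op d) (R.rig.res le_top x) = S.rig.res le_top (Γ.map F x) :=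
  (res_map_app F le_top x).trans (S.rig.res_res _ _ _).symm

end RigRep

/-! ### The universal property of the representation -/

namespace IRig

variable {A : IRig.{u}} {R : RigRep.{u}}

variable (A) in
/-- The canonical morphism from an integral rig to the global sections of its representation. -/
def repUnit : A ⟶ RigRep.Γ.obj A.rep := germ ⊤

theorem rep_extent_germ (d : A.reticulation) (a : A) :
    A.rep.extent d (germ d a) = eta a ⊓ d := by
  refine congrArg Subtype.val (RigRep.iic_ext (a := A.rep.chiFun d (germ d a))
    (b := ⟨eta a ⊓ d, Set.mem_Iic.2 inf_le_right⟩) fun c h => ?_)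
  refine (A.rep.le_chiFun (germ d a) h).trans (germ_eq_one.trans ?_)
  exact ⟨fun k => (le_inf k h : c ≤ eta a ⊓ d), fun k => le_trans k inf_le_left⟩

theorem rep_extent_repUnit (a : A) : A.rep.extent ⊤ (A.repUnit a) = eta a :=
  (rep_extent_germ ⊤ a).trans (inf_top_eq _)

/-- The extent of `A.repUnit a` is `eta a`, so the action on global sections determines the base
map. Every section is a restriction of a global one, so naturality determines the rest. -/
theorem rep_hom_ext {F G : A.rep ⟶ R}
    (h : ∀ a : A, RigRep.Γ.map F (A.repUnit a) = RigRep.Γ.map G (A.repUnit a)) : F = G := by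
  have hbase : F.base = G.base := ret_hom_ext fun a => by
    rw [← rep_extent_repUnit]
    exact (RigRep.extent_Γ_map F _).symm.trans
      ((congrArg (R.extent ⊤) (h a)).trans (RigRep.extent_Γ_map G _))
  -- The two sheaf maps have different targets until the bases are identified; the common `k` allows
  -- them to be compared afterwards.
  have hmap : ∃ k : A → RigRep.Γ.obj R, ∀ (d : A.reticulation) (a : A),
      F.map.app (op d) (germ d a) = R.rig.res le_top (k a) ∧
      G.map.app (op d) (germ d a) = R.rig.res le_top (k a) :=
    ⟨fun a => RigRep.Γ.map G (A.repUnit a), fun d a =>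
      ⟨(RigRep.map_app_res_top F d (A.repUnit a)).trans (congrArg _ (h a)),
        RigRep.map_app_res_top G d (A.repUnit a)⟩⟩
  obtain ⟨k, hk⟩ := hmap
  clear h
  obtain ⟨f, φ, hφ⟩ := F
  obtain ⟨g, γ, hγ⟩ := G
  obtain rfl : f = g := hbase
  obtain rfl : φ = γ := by
    refine NatTrans.ext (funext fun d => RigPreorder.quot_hom_ext fun a => ?_)
    exact (hk d.unop a).1.trans (hk d.unop a).2.symm
  rfl

/-- The morphism of lattices that corresponds to a morphism to the global sections. -/
noncomputable def repBase (g : A ⟶ RigRep.Γ.obj R) : A.reticulation ⟶ R.lat :=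
  retLift (g ≫ R.chiTop)

theorem res_mono_of_locPreorder (g : A ⟶ RigRep.Γ.obj R) {d : A.reticulation} (a b : A)
    (h : (locPreorder d).rel a b) :
    (g ≫ R.rig.res (c := repBase g d) le_top) a ≤ (g ≫ R.rig.res (c := repBase g d) le_top) b := by
  obtain ⟨z, hz, hzab⟩ := h
  -- The base map sends `eta z` to the extent of `g z`, so `d ≤ eta z` makes this restriction
  -- trivial.
  have hz' : (g ≫ R.rig.res (c := repBase g d) le_top) z = 1 :=
    (R.le_chiFun (g z) le_top).1 (OrderHomClass.mono (repBase g).hom hz)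
  have h := hom_mono (g ≫ R.rig.res (c := repBase g d) le_top) hzab
  rwa [map_mul, hz', one_mul] at h

/-- The morphism of representations that corresponds to a morphism to the global sections. -/
noncomputable def repLift (g : A ⟶ RigRep.Γ.obj R) : A.rep ⟶ R where
  base := repBase g
  map :=
    { app := fun d => RigPreorder.lift (g ≫ R.rig.res (c := repBase g d.unop) le_top)
        (res_mono_of_locPreorder g)
      naturality := fun d c f => RigPreorder.quot_hom_ext fun a =>
        (R.rig.res_res (OrderHomClass.mono (repBase g).hom (leOfHom f.unop)) le_top (g a)).symm }
  comm := by
    refine NatTrans.ext (funext fun d => RigPreorder.quot_hom_ext fun a => Subtype.ext ?_)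
    refine (RigRep.extent_res le_top (g a)).trans ?_
    exact (map_inf (repBase g).hom (eta a) d.unop).symm.trans
      (congrArg (repBase g) (rep_extent_germ d.unop a).symm)

theorem Γ_map_repLift_repUnit (g : A ⟶ RigRep.Γ.obj R) (a : A) :
    RigRep.Γ.map (repLift g) (A.repUnit a) = g a :=
  (R.rig.res_res _ _ _).trans (R.rig.res_self le_rfl (g a))

variable (A R) in
/-- Morphisms from the representation of `A` correspond to morphisms from `A` to the global
sections. -/
noncomputable def repHomEquiv : (A.rep ⟶ R) ≃ (A ⟶ RigRep.Γ.obj R) where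
  toFun F := A.repUnit ≫ RigRep.Γ.map F
  invFun := repLift
  left_inv _ := rep_hom_ext fun a => Γ_map_repLift_repUnit _ a
  right_inv g := hom_ext fun a => Γ_map_repLift_repUnit g a

theorem repHomEquiv_comp (A : IRig.{u}) (R S : RigRep.{u}) (G : R ⟶ S) (F : A.rep ⟶ R) :
    repHomEquiv A S (F ≫ G) = repHomEquiv A R F ≫ RigRep.Γ.map G := by
  change A.repUnit ≫ RigRep.Γ.map (F ≫ G) = (A.repUnit ≫ RigRep.Γ.map F) ≫ RigRep.Γ.map G
  rw [Functor.map_comp, Category.assoc]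

/-- The functor that sends an integral rig to its representation. -/
noncomputable def repFunctor : IRig.{u} ⥤ RigRep.{u} :=
  Adjunction.leftAdjointOfEquiv (F_obj := rep) repHomEquiv repHomEquiv_comp

/-- The representation functor is left adjoint to global sections. -/
noncomputable def repAdjunction : repFunctor.{u} ⊣ RigRep.Γ.{u} :=
  Adjunction.adjunctionOfEquivLeft repHomEquiv repHomEquiv_comp

theorem repAdjunction_unit_app (A : IRig.{u}) :
    repAdjunction.unit.app A = A.repUnit := by
  rw [repAdjunction, Adjunction.adjunctionOfEquivLeft_unit_app]
  change A.repUnit ≫ RigRep.Γ.map (𝟙 A.rep) = _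
  rw [RigRep.Γ.map_id, Category.comp_id]

theorem isIso_repUnit (A : IRig.{u}) : IsIso A.repUnit := by
  let e := RingEquiv.ofBijective A.repUnit.hom
    ⟨germ_top_injective, germ_surjective ⊤⟩
  exact ⟨⟨e.symm.toRingHom⟩, hom_ext e.symm_apply_apply, hom_ext e.apply_symm_apply⟩

/-- Naturality of the unit, read through extents. It identifies the lattice part of the left adjoint
with the reticulation on morphisms as well. -/
theorem repFunctor_map_base_eta {A B : IRig.{u}} (f : A ⟶ B) (a : A) :
    (repFunctor.map f).base (eta a) = eta (f a) := by
  have h := congrArg (fun k : A ⟶ RigRep.Γ.obj B.rep => k a) (repAdjunction.unit.naturality f)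
  rw [repAdjunction_unit_app, repAdjunction_unit_app] at h
  rw [← rep_extent_repUnit, ← rep_extent_repUnit]
  exact (RigRep.extent_Γ_map (repFunctor.map f) (A.repUnit a)).symm.trans
    (congrArg (B.rep.extent ⊤) h.symm)

/-- Morphisms from the reticulation to a distributive lattice correspond to morphisms from the
integral rig. -/
def retHomEquiv (A : IRig.{u}) (M : BddDistLat.{u}) :
    (A.reticulation ⟶ M) ≃ (A ⟶ dLatToIRig.obj M) where
  toFun f := A.toRet ≫ dLatToIRig.map f
  invFun := retLift
  left_inv _ := ret_hom_ext fun _ => rfl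
  right_inv _ := rfl

/-- The lattice of the representation of an integral rig is its reticulation. -/
noncomputable def retAdjunction : repFunctor.{u} ⋙ RigRep.lattice.{u} ⊣ dLatToIRig.{u} :=
  Adjunction.mkOfHomEquiv
    { homEquiv := retHomEquiv
      homEquiv_naturality_left_symm := fun f g => ret_hom_ext fun a =>
        (congrArg (retLift g) (repFunctor_map_base_eta f a)).symm
      homEquiv_naturality_right := fun _ _ => rfl }

/-- A multiplier `z` with `eta x ≤ eta z` dominates a power of `x`, so a morphism sending `x` to `1`
respects the preorder at `eta x`. -/
theorem isLocalizationAt_germ_eta (x : A) : IsLocalizationAt x (germ (eta x)) where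
  isUnit := by
    rintro _ ⟨n, rfl⟩
    rw [isUnit_iff, germ_eq_one]
    exact eta_pow_le x n
  lift C g hg := by
    have hx : g x = 1 := (isUnit_iff _ _).1 (hg x (Submonoid.mem_powers x))
    refine ⟨RigPreorder.lift g ?_, rfl, fun h hh => RigPreorder.quot_hom_ext fun a => ?_⟩
    · rintro a b ⟨z, hz, hzab⟩
      obtain ⟨n, hn⟩ := eta_le_eta.1 hz
      have h := hom_mono g ((mul_le_mul_left hn a).trans hzab)
      rwa [map_mul, map_pow, hx, one_pow, one_mul] at h
    · exact congrArg (fun k : A ⟶ C => k a) hh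

end IRig

theorem mainTheorem1 :
    ∃ (F : IRig.{u} ⥤ RigRep.{u}) (adj : F ⊣ RigRep.Γ.{u})
      (ret : F ⋙ RigRep.lattice.{u} ⊣ dLatToIRig.{u}),
      F.Full ∧ F.Faithful ∧
      (∀ A : IRig.{u}, Function.Surjective (ret.unit.app A)) ∧
      (∀ (A : IRig.{u}) (x : A),
        IRig.IsLocalizationAt x
          (adj.unit.app A ≫ (F.obj A).rig.res (c := ret.unit.app A x) (d := ⊤) le_top)) ∧
      ∀ A : IRig.{u}, IsIso (adj.unit.app A) := by
  have hiso : ∀ A : IRig.{u}, IsIso (IRig.repAdjunction.unit.app A) := fun A => by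
    rw [IRig.repAdjunction_unit_app]
    exact A.isIso_repUnit
  have : IsIso IRig.repAdjunction.{u}.unit := NatIso.isIso_of_isIso_app _
  have hff := IRig.repAdjunction.{u}.fullyFaithfulLOfIsIsoUnit
  refine ⟨IRig.repFunctor, IRig.repAdjunction, IRig.retAdjunction, hff.full, hff.faithful,
    fun A => IRig.eta_surjective, fun A x => ?_, hiso⟩
  rw [IRig.repAdjunction_unit_app]
  -- Restricting `germ ⊤` to `eta x` gives `germ (eta x)` by definition.
  exact IRig.isLocalizationAt_germ_eta x
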